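/- For an integer $k\ge 0$ let \[P_k=\langle a,b \mid ab^{2^k}a^{-1}b^{2^k},\; ba^2b^{-1}a^2\rangle ,\] and let $P=\langle x,y\mid xy^2x^{-1}y^2,\; yx^2y^{-1}x^2\rangle$ be Promislow's group (so $P=P_1$). \begin{enumerate} \item If $k_1\neq k_2$ are natural numbers, then $P_{k_1}$ is not isomorphic to $P_{k_2}$; moreover, the abelianizations of $P_{k_1}$ and $P_{k_2}$ are not isomorphic. \item If $k>1$, then $P_k$ has no subgroup isomorphic to $P$. \end{enumerate} -/

import Mathlib

/-- The relators `a b^(2^k) a⁻¹ b^(2^k)` and `b a² b⁻¹ a²`, as elements of the free group on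
`a = FreeGroup.of 0` and `b = FreeGroup.of 1`. -/
def relatorsP (k : ℕ) : Set (FreeGroup (Fin 2)) :=
  let a : FreeGroup (Fin 2) := FreeGroup.of 0
  let b : FreeGroup (Fin 2) := FreeGroup.of 1
  {a * b ^ (2 ^ k) * a⁻¹ * b ^ (2 ^ k), b * a ^ 2 * b⁻¹ * a ^ 2}

/-- The group `P_k = ⟨a, b ∣ a b^(2^k) a⁻¹ b^(2^k), b a² b⁻¹ a²⟩`. -/
abbrev GroupP (k : ℕ) : Type := PresentedGroup (relatorsP k)

/-- The relators `x y² x⁻¹ y²` and `y x² y⁻¹ x²`. -/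
def promislowRelators : Set (FreeGroup (Fin 2)) :=
  let x : FreeGroup (Fin 2) := FreeGroup.of 0
  let y : FreeGroup (Fin 2) := FreeGroup.of 1
  {x * y ^ 2 * x⁻¹ * y ^ 2, y * x ^ 2 * y⁻¹ * x ^ 2}

/-- Promislow's group `P = ⟨x, y ∣ x y² x⁻¹ y², y x² y⁻¹ x²⟩`. -/
abbrev PromislowGroup : Type := PresentedGroup promislowRelators

/-- `P` and `P_1` are given by the same presentation. -/
theorem relatorsP_one : relatorsP 1 = promislowRelators := by
  simp [relatorsP, promislowRelators]

/-! For the first claim, the abelianization of `P_k` is `ℤ/4 × ℤ/2^(k+1)`, and its order determines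
`k`.

For the second, `x`, `y` and `xy` in `P` have infinite order, and any two of them invert each
other's squares. Suppose `P` embeds in `P_k`. The subgroup `core k` generated by `a²` and `b^(2^k)`
is normal and abelian, and the quotient `ℤ/2 * ℤ/2^k` is free-by-finite. There, one of two elements
inverting each other's squares has finite order (`pow_eq_one_or_of_freeGroup`), so at least two of
the three images, say `u` and `v`, have their `2^k`-th power in `core k`. Elements act on `core k`
through `sign`, and the relations between `u` and `v` force their signs to be `(1, -1)` and `(-1,
1)` in some order. For `k > 1`, the finite quotient of `P_k` in `ℤ/2 ≀ ℤ/4` shows that such elements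
cannot satisfy the relations (`not_conj_sq_of_sign`). -/

/-! ### Homomorphisms out of cyclic groups and out of `P_k` -/

/-- The homomorphism from `ℤ/n` determined by an element whose `n`-th power is trivial. -/
def zmodPowHom {n : ℕ} {G : Type*} [Group G] (g : G) (h : g ^ n = 1) :
    Multiplicative (ZMod n) →* G :=
  AddMonoidHom.toMultiplicativeLeft
    (ZMod.lift n ⟨zmultiplesHom (Additive G) (Additive.ofMul g), by
      simpa [← ofMul_pow] using h⟩)

theorem zmodPowHom_one {n : ℕ} {G : Type*} [Group G] (g : G) (h : g ^ n = 1) :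
    zmodPowHom g h (Multiplicative.ofAdd 1) = g := by
  have := ZMod.lift_coe n ⟨zmultiplesHom (Additive G) (Additive.ofMul g), by
      simpa [← ofMul_pow] using h⟩ 1
  simp only [Int.cast_one] at this
  simp [zmodPowHom, this]

/-- Homomorphisms from `ℤ/n` agree as soon as they agree on the generator. -/
theorem zmodHom_ext {n : ℕ} {G : Type*} [Monoid G] {f g : Multiplicative (ZMod n) →* G}
    (h : f (Multiplicative.ofAdd 1) = g (Multiplicative.ofAdd 1)) : f = g := by
  refine MonoidHom.ext fun i => ?_
  obtain ⟨m, hm⟩ := ZMod.intCast_surjective (Multiplicative.toAdd i)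
  have key : f.comp (zpowersHom _ (Multiplicative.ofAdd (1 : ZMod n))) =
      g.comp (zpowersHom _ (Multiplicative.ofAdd (1 : ZMod n))) :=
    MonoidHom.ext_mint (by simpa using h)
  have hi : i = zpowersHom _ (Multiplicative.ofAdd (1 : ZMod n)) (Multiplicative.ofAdd m) := by
    rw [zpowersHom_apply, toAdd_ofAdd, ← ofAdd_zsmul, zsmul_one, hm, ofAdd_toAdd]
  rw [hi]
  exact DFunLike.congr_fun key (Multiplicative.ofAdd m)

namespace GroupP

variable {k : ℕ}

/-- The generator `a` of `P_k`. -/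
def a : GroupP k := PresentedGroup.of 0

/-- The generator `b` of `P_k`. -/
def b : GroupP k := PresentedGroup.of 1

theorem conj_a : (a : GroupP k) * b ^ 2 ^ k * a⁻¹ * b ^ 2 ^ k = 1 :=
  PresentedGroup.one_of_mem (rels := relatorsP k) (Set.mem_insert _ _)

theorem conj_b : (b : GroupP k) * a ^ 2 * b⁻¹ * a ^ 2 = 1 :=
  PresentedGroup.one_of_mem (rels := relatorsP k) (Set.mem_insert_of_mem _ rfl)

/-- The universal property of `P_k`. -/
def lift {G : Type*} [Group G] (x y : G) (h₁ : x * y ^ 2 ^ k * x⁻¹ * y ^ 2 ^ k = 1)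
    (h₂ : y * x ^ 2 * y⁻¹ * x ^ 2 = 1) : GroupP k →* G :=
  PresentedGroup.toGroup (f := ![x, y]) (by
    rintro r (rfl | rfl)
    · simpa using h₁
    · simpa using h₂)

section

variable {G : Type*} [Group G] (x y : G) (h₁ : x * y ^ 2 ^ k * x⁻¹ * y ^ 2 ^ k = 1)
    (h₂ : y * x ^ 2 * y⁻¹ * x ^ 2 = 1)

@[simp] theorem lift_a : lift x y h₁ h₂ a = x := PresentedGroup.toGroup.of _

@[simp] theorem lift_b : lift x y h₁ h₂ b = y := PresentedGroup.toGroup.of _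

end

theorem hom_ext {G : Type*} [Monoid G] {f g : GroupP k →* G} (ha : f a = g a) (hb : f b = g b) :
    f = g := by
  apply MonoidHom.eq_of_eqOn_dense (PresentedGroup.closure_range_of (relatorsP k))
  rintro _ ⟨i, rfl⟩
  fin_cases i
  exacts [ha, hb]

theorem induction {C : GroupP k → Prop} (ha : C a) (hb : C b) (one : C 1)
    (mul : ∀ x y, C x → C y → C (x * y)) (inv : ∀ x, C x → C x⁻¹) (g : GroupP k) : C g := by
  have hg : g ∈ Subgroup.closure (Set.range (PresentedGroup.of (rels := relatorsP k))) := by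
    rw [PresentedGroup.closure_range_of]; trivial
  induction hg using Subgroup.closure_induction with
  | mem x hx =>
    obtain ⟨i, rfl⟩ := hx
    fin_cases i
    exacts [ha, hb]
  | one => exact one
  | mul x y _ _ hx hy => exact mul x y hx hy
  | inv x _ hx => exact inv x hx

/-! ### The abelianization -/

theorem ofAdd_one_pow_self (n : ℕ) : (Multiplicative.ofAdd (1 : ZMod n)) ^ n = 1 := by
  rw [← ofAdd_nsmul]; simp

/-- The map from `P_k` to its abelianization `ℤ/4 × ℤ/2^(k+1)`. -/
def toZMod (k : ℕ) :
    GroupP k →* Multiplicative (ZMod 4) × Multiplicative (ZMod (2 ^ (k + 1))) :=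
  lift (Multiplicative.ofAdd 1, 1) (1, Multiplicative.ofAdd 1)
    (by
      ext1
      · simp
      · simpa [← pow_add, ← two_mul, ← pow_succ'] using ofAdd_one_pow_self (2 ^ (k + 1)))
    (by
      have := ofAdd_one_pow_self 4
      ext1
      · simpa [← pow_add] using this
      · simp)

theorem ab_a_pow : (Abelianization.of (a : GroupP k)) ^ 4 = 1 := by
  have := congrArg Abelianization.of (conj_b (k := k))
  simpa [mul_comm, ← pow_add] using this

theorem ab_b_pow : (Abelianization.of (b : GroupP k)) ^ 2 ^ (k + 1) = 1 := by
  have := congrArg Abelianization.of (conj_a (k := k))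
  simpa [mul_comm, ← pow_add, ← two_mul, ← pow_succ'] using this

/-- The abelianization of `P_k` is `ℤ/4 × ℤ/2^(k+1)`. -/
def abelianizationEquiv (k : ℕ) : Abelianization (GroupP k) ≃*
    Multiplicative (ZMod 4) × Multiplicative (ZMod (2 ^ (k + 1))) :=
  MonoidHom.toMulEquiv (Abelianization.lift (toZMod k))
    ((zmodPowHom _ ab_a_pow).coprod (zmodPowHom _ ab_b_pow))
    (by
      apply Abelianization.hom_ext
      apply hom_ext <;> simp [toZMod, zmodPowHom_one])
    (by
      rw [← MonoidHom.coprod_inl_inr, MonoidHom.comp_coprod]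
      congr 1 <;> apply zmodHom_ext <;> simp [toZMod, zmodPowHom_one])

theorem card_abelianization (k : ℕ) : Nat.card (Abelianization (GroupP k)) = 4 * 2 ^ (k + 1) := by
  rw [Nat.card_congr (abelianizationEquiv k).toEquiv, Nat.card_prod]
  simp

theorem isEmpty_abelianization_mulEquiv {k₁ k₂ : ℕ} (h : k₁ ≠ k₂) :
    IsEmpty (Abelianization (GroupP k₁) ≃* Abelianization (GroupP k₂)) := by
  refine ⟨fun e => h ?_⟩
  have := Nat.card_congr e.toEquiv
  simpa [card_abelianization] using this

end GroupP

/-! ### Commuting elements of free groups -/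

theorem IsFreeGroup.isCyclic_of_commute {G : Type*} [Group G] [IsFreeGroup G]
    (h : ∀ x y : G, x * y = y * x) : IsCyclic G := by
  have e := IsFreeGroup.toFreeGroup G
  have hsub : Subsingleton (IsFreeGroup.Generators G) := by
    refine ⟨fun i j => ?_⟩
    by_contra hij
    classical
    -- Two distinct generators would map to non-commuting transpositions of `S₃`.
    let f : IsFreeGroup.Generators G → Equiv.Perm (Fin 3) :=
      fun l => if l = i then Equiv.swap 0 1 else Equiv.swap 1 2
    have := congrArg (FreeGroup.lift f) (show FreeGroup.of i * FreeGroup.of j =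
      FreeGroup.of j * FreeGroup.of i from e.symm.injective (by simp [h]))
    have hne : Equiv.swap (0 : Fin 3) 1 * Equiv.swap 1 2 ≠ Equiv.swap 1 2 * Equiv.swap 0 1 := by
      decide
    simp [f, Ne.symm hij] at this
    exact hne this
  have : IsCyclic (FreeGroup (IsFreeGroup.Generators G)) := by
    cases isEmpty_or_nonempty (IsFreeGroup.Generators G) with
    | inl h => infer_instance
    | inr h =>
      have := uniqueOfSubsingleton h.some
      infer_instance
  exact isCyclic_of_surjective e.symm e.symm.surjective

/-- Two commuting elements of a free group are powers of a common element. -/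
theorem FreeGroup.exists_zpow_of_commute {α : Type*} {u v : FreeGroup α} (h : Commute u v) :
    ∃ (c : FreeGroup α) (i j : ℤ), c ^ i = u ∧ c ^ j = v := by
  let H := Subgroup.closure {u, v}
  have hH : ∀ x y : H, x * y = y * x := by
    have : ∀ x ∈ ({u, v} : Set (FreeGroup α)), ∀ y ∈ ({u, v} : Set (FreeGroup α)),
        x * y = y * x := by
      rintro x (rfl | rfl) y (rfl | rfl)
      exacts [rfl, h, h.symm, rfl]
    have := Subgroup.isMulCommutative_closure this
    exact fun x y => mul_comm' x y
  obtain ⟨c, hc⟩ := IsFreeGroup.isCyclic_of_commute hH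
  obtain ⟨i, hi⟩ := hc ⟨u, Subgroup.subset_closure (by simp)⟩
  obtain ⟨j, hj⟩ := hc ⟨v, Subgroup.subset_closure (by simp)⟩
  exact ⟨c, i, j, congrArg Subtype.val hi, congrArg Subtype.val hj⟩

/-! ### Pairs of elements inverting each other's squares -/

/-- `u` and `v` satisfy the defining relations of Promislow's group. -/
structure InvertSquares {G : Type*} [Group G] (u v : G) : Prop where
  left : u * v ^ 2 * u⁻¹ * v ^ 2 = 1
  right : v * u ^ 2 * v⁻¹ * u ^ 2 = 1

namespace InvertSquares

variable {G H : Type*} [Group G] [Group H] {u v : G}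

theorem symm (h : InvertSquares u v) : InvertSquares v u := ⟨h.2, h.1⟩

theorem map (h : InvertSquares u v) (f : G →* H) : InvertSquares (f u) (f v) :=
  ⟨by simpa using congrArg f h.1, by simpa using congrArg f h.2⟩

theorem conj_sq (h : InvertSquares u v) : u * v ^ 2 * u⁻¹ = (v ^ 2)⁻¹ :=
  eq_inv_of_mul_eq_one_left h.1

theorem conj_pow (h : InvertSquares u v) {n : ℕ} (hn : Even n) : u * v ^ n * u⁻¹ = (v ^ n)⁻¹ := by
  obtain ⟨m, rfl⟩ := hn.two_dvd
  rw [pow_mul, ← _root_.conj_pow, h.conj_sq, inv_pow]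

theorem commute_pow (h : InvertSquares u v) {m n : ℕ} (hm : Even m) (hn : Even n) :
    Commute (u ^ m) (v ^ n) := by
  obtain ⟨m, rfl⟩ := hm.two_dvd
  rw [pow_mul]
  refine Commute.pow_left ?_ m
  have h1 := h.conj_pow hn
  have h2 : u * (u * v ^ n * u⁻¹) * u⁻¹ = v ^ n := by
    rw [h1, ← conj_inv, h1, inv_inv]
  calc u ^ 2 * v ^ n = u * (u * v ^ n * u⁻¹) * u⁻¹ * u ^ 2 := by simp only [sq]; group
    _ = v ^ n * u ^ 2 := by rw [h2]

theorem sq_mul (h : InvertSquares u v) : v ^ 2 * u = u * (v ^ 2)⁻¹ := by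
  calc v ^ 2 * u = v ^ 2 * (u * v ^ 2 * u⁻¹) * u * (v ^ 2)⁻¹ := by group
    _ = u * (v ^ 2)⁻¹ := by rw [h.conj_sq]; group

/-- With `mul_self`, this makes `u`, `v`, `uv` a triple in which every pair inverts each other's
squares; the pigeonhole argument at the end needs all three pairs. -/
theorem self_mul (h : InvertSquares u v) : InvertSquares u (u * v) where
  left := by
    calc u * (u * v) ^ 2 * u⁻¹ * (u * v) ^ 2 = u ^ 2 * v * u * (v ^ 2 * u) * v := by simp only [sq]; group
      _ = u ^ 2 * (v * u ^ 2 * v⁻¹) := by rw [h.sq_mul]; simp only [sq]; group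
      _ = 1 := by rw [h.symm.conj_sq, mul_inv_cancel]
  right := by
    calc u * v * u ^ 2 * (u * v)⁻¹ * u ^ 2 = u * (v * u ^ 2 * v⁻¹) * u := by group
      _ = 1 := by rw [h.symm.conj_sq]; group

theorem mul_self (h : InvertSquares u v) : InvertSquares v (u * v) where
  left := by
    calc v * (u * v) ^ 2 * v⁻¹ * (u * v) ^ 2 = v * u * v * (u ^ 2 * v) * u * v := by simp only [sq]; group
      _ = v * (u * v ^ 2 * u⁻¹) * v := by rw [h.symm.sq_mul]; simp only [sq]; group
      _ = 1 := by rw [h.conj_sq]; group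
  right := by
    calc u * v * v ^ 2 * (u * v)⁻¹ * v ^ 2 = u * v ^ 2 * u⁻¹ * v ^ 2 := by group
      _ = 1 := h.left

/-- In an extension of a torsion group by a free group, one of two elements that invert each
other's squares has finite order. -/
theorem pow_eq_one_or_of_freeGroup {α : Type*} {T : Type*} [Group T]
    {φ : T →* MulAut (FreeGroup α)} {u v : FreeGroup α ⋊[φ] T} (h : InvertSquares u v)
    {n : ℕ} (hn : Even n) (hT : ∀ t : T, t ^ n = 1) : u ^ n = 1 ∨ v ^ n = 1 := by
  have hker : ∀ g : FreeGroup α ⋊[φ] T, ∃ x, SemidirectProduct.inl x = g ^ n := by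
    intro g
    rw [← MonoidHom.mem_range, SemidirectProduct.range_inl_eq_ker_rightHom, MonoidHom.mem_ker,
      map_pow, hT]
  obtain ⟨x, hx⟩ := hker u
  obtain ⟨y, hy⟩ := hker v
  have hxy : Commute x y := by
    have := h.commute_pow hn hn
    rw [← hx, ← hy] at this
    exact SemidirectProduct.inl_injective (by simpa using this.eq)
  obtain ⟨c, i, j, rfl, rfl⟩ := FreeGroup.exists_zpow_of_commute hxy
  by_cases hi : i = 0
  · left; rw [← hx, hi]; simp
  by_cases hj : j = 0
  · right; rw [← hy, hj]; simp
  -- The element `(v ^ n) ^ i = (u ^ n) ^ j = c ^ (i * j)` is both inverted and fixed by conjugation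
  -- by `u`, so `c ^ (2 * i * j) = 1`, and free groups are torsion-free.
  have h1 : u * (v ^ n) ^ i * u⁻¹ = ((v ^ n) ^ i)⁻¹ := by
    rw [← conj_zpow, h.conj_pow hn, inv_zpow]
  have h2 : (v ^ n) ^ i = (u ^ n) ^ j := by
    rw [← hx, ← hy, ← map_zpow, ← map_zpow, ← zpow_mul, ← zpow_mul, mul_comm]
  have h3 : u * (u ^ n) ^ j * u⁻¹ = (u ^ n) ^ j := by
    rw [mul_inv_eq_iff_eq_mul]
    exact (((Commute.refl u).pow_right n).zpow_right j)
  rw [h2, h3, ← hx, ← map_zpow, ← map_inv] at h1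
  have h4 := SemidirectProduct.inl_injective h1
  rw [eq_inv_iff_mul_eq_one, ← zpow_mul, ← zpow_add] at h4
  have h5 : c = 1 := by
    have hij := mul_ne_zero hi hj
    refine (IsMulTorsionFree.zpow_eq_one_iff_left ?_).1 h4
    omega
  left; rw [← hx, h5]; simp

end InvertSquares

/-! ### Elements of Promislow's group of infinite order -/

namespace GroupP

-- `DihedralGroup 0` is the infinite dihedral group, whose rotation `r 1` has infinite order. Each
-- of `a`, `b`, `ab` is sent to `r 1` by a suitable map from `P`.
open DihedralGroup in
theorem pow_ne_one_of_map_eq_r_one {G : Type*} [Group G] (f : G →* DihedralGroup 0) {g : G}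
    (hg : f g = r 1) {n : ℕ} (hn : n ≠ 0) : g ^ n ≠ 1 := by
  intro h
  have := congrArg f h
  rw [map_pow, hg, map_one, ← orderOf_dvd_iff_pow_eq_one, orderOf_r_one] at this
  exact hn (Nat.eq_zero_of_zero_dvd this)

theorem invertSquares_generators : InvertSquares (a : GroupP 1) b := ⟨conj_a, conj_b⟩

open DihedralGroup in
theorem a_pow_ne_one {n : ℕ} (hn : n ≠ 0) : (a : GroupP 1) ^ n ≠ 1 :=
  pow_ne_one_of_map_eq_r_one (lift (r 1) (sr 0) (by decide) (by decide)) (lift_a ..) hn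

open DihedralGroup in
theorem b_pow_ne_one {n : ℕ} (hn : n ≠ 0) : (b : GroupP 1) ^ n ≠ 1 :=
  pow_ne_one_of_map_eq_r_one (lift (sr 0) (r 1) (by decide) (by decide)) (lift_b ..) hn

open DihedralGroup in
theorem a_mul_b_pow_ne_one {n : ℕ} (hn : n ≠ 0) : ((a : GroupP 1) * b) ^ n ≠ 1 :=
  pow_ne_one_of_map_eq_r_one (lift (sr 0) (sr 1) (by decide) (by decide))
    (by rw [map_mul, lift_a, lift_b, sr_mul_sr, sub_zero]) hn

end GroupP

namespace GroupP

/-! ### The normal subgroup generated by `a²` and `b^(2^k)` -/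

variable {k : ℕ}

theorem conj_eq_zpow (e : GroupP k →* ℤˣ) (z : GroupP k) (ha : a * z * a⁻¹ = z ^ (e a : ℤ))
    (hb : b * z * b⁻¹ = z ^ (e b : ℤ)) (g : GroupP k) : g * z * g⁻¹ = z ^ (e g : ℤ) := by
  refine induction (C := fun g => g * z * g⁻¹ = z ^ (e g : ℤ)) ha hb (by simp) ?_ ?_ g
  · intro x y hx hy
    calc x * y * z * (x * y)⁻¹ = x * (y * z * y⁻¹) * x⁻¹ := by group
      _ = z ^ (e (x * y) : ℤ) := by
        rw [hy, ← conj_zpow, hx, ← zpow_mul, map_mul, Units.val_mul]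
  · intro x hx
    have h : x * z ^ (e x : ℤ) * x⁻¹ = z := by
      rw [← conj_zpow, hx, ← zpow_mul, ← Units.val_mul, Int.units_mul_self, Units.val_one, zpow_one]
    rw [map_inv, Int.units_inv_eq_self, inv_inv]
    nth_rw 1 [← h]
    group

/-- The signs by which an element of `P_k` acts by conjugation on `a²` and on `b^(2^k)`. -/
def sign : GroupP k →* ℤˣ × ℤˣ :=
  lift (1, -1) (-1, 1)
    (by rw [mul_inv_cancel_comm, ← mul_pow]; simp)
    (by rw [mul_inv_cancel_comm, ← mul_pow]; simp)

theorem conj_a_sq (g : GroupP k) : g * a ^ 2 * g⁻¹ = (a ^ 2) ^ ((sign g).1 : ℤ) := by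
  refine conj_eq_zpow ((MonoidHom.fst _ _).comp sign) _ ?_ ?_ g
  · simp [sign]; group
  · simpa [sign] using eq_inv_of_mul_eq_one_left conj_b

theorem conj_b_pow (g : GroupP k) : g * b ^ 2 ^ k * g⁻¹ = (b ^ 2 ^ k) ^ ((sign g).2 : ℤ) := by
  refine conj_eq_zpow ((MonoidHom.snd _ _).comp sign) _ ?_ ?_ g
  · simpa [sign] using eq_inv_of_mul_eq_one_left conj_a
  · simp [sign, ← pow_succ', pow_succ]

theorem commute_a_sq_b_pow : Commute ((a : GroupP k) ^ 2) (b ^ 2 ^ k) := by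
  have := conj_b_pow ((a : GroupP k) ^ 2)
  rw [mul_inv_eq_iff_eq_mul] at this
  simpa [sign, Commute, SemiconjBy] using this

/-- The normal subgroup of `P_k` generated by `a²` and `b^(2^k)`. -/
def core (k : ℕ) : Subgroup (GroupP k) := Subgroup.normalClosure {a ^ 2, b ^ 2 ^ k}

instance : (core k).Normal := Subgroup.normalClosure_normal

/-- Conjugates of `a²` and `b^(2^k)` are their powers with exponent `±1`, and the two commute, so
the normal closure is no larger than the subgroup they generate. -/
theorem exists_zpow_of_mem_core {z : GroupP k} (hz : z ∈ core k) :
    ∃ i j : ℤ, z = (a ^ 2) ^ i * (b ^ 2 ^ k) ^ j := by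
  have hc : ∀ i j : ℤ, Commute (((a : GroupP k) ^ 2) ^ i) ((b ^ 2 ^ k) ^ j) := fun i j =>
    (commute_a_sq_b_pow.zpow_left i).zpow_right j
  rw [core, Subgroup.normalClosure] at hz
  induction hz using Subgroup.closure_induction with
  | mem x hx =>
    rw [Group.mem_conjugatesOfSet_iff] at hx
    obtain ⟨y, hy, hyx⟩ := hx
    obtain ⟨g, rfl⟩ := isConj_iff.1 hyx
    rcases hy with rfl | rfl
    · exact ⟨(sign g).1, 0, by rw [conj_a_sq]; simp⟩
    · exact ⟨0, (sign g).2, by rw [conj_b_pow]; simp⟩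
  | one => exact ⟨0, 0, by simp⟩
  | mul x y _ _ hx hy =>
    obtain ⟨i, j, rfl⟩ := hx
    obtain ⟨i', j', rfl⟩ := hy
    exact ⟨i + i', j + j', by
      rw [zpow_add, zpow_add, (hc i' j).symm.mul_mul_mul_comm]⟩
  | inv x _ hx =>
    obtain ⟨i, j, rfl⟩ := hx
    exact ⟨-i, -j, by rw [mul_inv_rev, ← zpow_neg, ← zpow_neg, (hc _ _).eq]⟩

/-- Conjugation on `core k` depends only on the signs. -/
theorem conj_of_mem_core {z : GroupP k} (hz : z ∈ core k) :
    ∃ i j : ℤ, z = (a ^ 2) ^ i * (b ^ 2 ^ k) ^ j ∧ ∀ g, g * z * g⁻¹ =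
      ((a ^ 2) ^ ((sign g).1 : ℤ)) ^ i * ((b ^ 2 ^ k) ^ ((sign g).2 : ℤ)) ^ j := by
  obtain ⟨i, j, rfl⟩ := exists_zpow_of_mem_core hz
  exact ⟨i, j, rfl, fun g => by rw [← conj_a_sq, ← conj_b_pow, conj_zpow, conj_zpow]; group⟩

theorem conj_eq_conj_of_sign_eq {z g h : GroupP k} (hz : z ∈ core k) (hgh : sign g = sign h) :
    g * z * g⁻¹ = h * z * h⁻¹ := by
  obtain ⟨i, j, -, hconj⟩ := conj_of_mem_core hz
  rw [hconj, hconj, hgh]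

theorem conj_eq_self_of_sign_eq_one {z g : GroupP k} (hz : z ∈ core k) (hg : sign g = 1) :
    g * z * g⁻¹ = z := by
  simpa using conj_eq_conj_of_sign_eq (h := 1) hz (by rw [hg, map_one])

theorem conj_eq_inv_of_sign_eq_neg_one {z g : GroupP k} (hz : z ∈ core k)
    (hg : sign g = (-1, -1)) : g * z * g⁻¹ = z⁻¹ := by
  obtain ⟨i, j, rfl, hconj⟩ := conj_of_mem_core hz
  rw [hconj, hg, mul_inv_rev, ← zpow_neg, ← zpow_neg,
    ((commute_a_sq_b_pow.zpow_left (-i)).zpow_right (-j)).symm.eq]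
  simp

/-! ### The quotient by `core k` embeds in a semidirect product with free kernel -/

/-- The endomorphism of the free group on `ℤ/n` that translates the generators and possibly
inverts them. -/
def signedShift {n : ℕ} (t : ℤˣ × Multiplicative (ZMod n)) :
    FreeGroup (Multiplicative (ZMod n)) →* FreeGroup (Multiplicative (ZMod n)) :=
  FreeGroup.lift fun i => FreeGroup.of (t.2 * i) ^ (t.1 : ℤ)

theorem signedShift_of {n : ℕ} (t : ℤˣ × Multiplicative (ZMod n)) (i : Multiplicative (ZMod n)) :
    signedShift t (FreeGroup.of i) = FreeGroup.of (t.2 * i) ^ (t.1 : ℤ) :=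
  FreeGroup.lift_apply_of

theorem signedShift_mul {n : ℕ} (s t : ℤˣ × Multiplicative (ZMod n)) :
    signedShift (s * t) = (signedShift s).comp (signedShift t) := by
  ext i
  rw [MonoidHom.comp_apply, signedShift_of, signedShift_of, map_zpow, signedShift_of, ← zpow_mul,
    Prod.fst_mul, Prod.snd_mul, Units.val_mul, mul_assoc]

theorem signedShift_one {n : ℕ} :
    signedShift (1 : ℤˣ × Multiplicative (ZMod n)) = MonoidHom.id _ := by
  ext i
  simp [signedShift_of]

/-- The action of `ℤ/2 × ℤ/n` on the free group on `ℤ/n` by inversion and translation of the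
generators. -/
def signedShiftAut (n : ℕ) :
    ℤˣ × Multiplicative (ZMod n) →* MulAut (FreeGroup (Multiplicative (ZMod n))) where
  toFun t := MonoidHom.toMulEquiv (signedShift t) (signedShift t⁻¹)
    (by rw [← signedShift_mul, inv_mul_cancel, signedShift_one])
    (by rw [← signedShift_mul, mul_inv_cancel, signedShift_one])
  map_one' := MulEquiv.ext fun x => DFunLike.congr_fun signedShift_one x
  map_mul' s t := MulEquiv.ext fun x => DFunLike.congr_fun (signedShift_mul s t) x

theorem signedShiftAut_apply {n : ℕ} (t : ℤˣ × Multiplicative (ZMod n))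
    (x : FreeGroup (Multiplicative (ZMod n))) : signedShiftAut n t x = signedShift t x := rfl

/-- The semidirect product of the free group on `ℤ/n` with `ℤ/2 × ℤ/n`. -/
abbrev FreeExt (n : ℕ) : Type :=
  FreeGroup (Multiplicative (ZMod n)) ⋊[signedShiftAut n] (ℤˣ × Multiplicative (ZMod n))

/-- The map from `P_k` to the semidirect product; its kernel lies in `core k`. -/
def toFreeExt (k : ℕ) : GroupP k →* FreeExt (2 ^ k) :=
  lift ⟨FreeGroup.of 1, (-1, 1)⟩ (SemidirectProduct.inr (1, Multiplicative.ofAdd 1))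
    (by
      have h : (SemidirectProduct.inr (1, Multiplicative.ofAdd 1) : FreeExt (2 ^ k)) ^ 2 ^ k = 1 := by
        rw [← map_pow, Prod.pow_mk, ofAdd_one_pow_self, one_pow, ← Prod.one_eq_mk, map_one]
      rw [h]; simp)
    (by
      -- The sign inverts the generator, so the square is `x₁ * x₁⁻¹`; this is why the action
      -- includes inversion.
      have h : (⟨FreeGroup.of 1, (-1, 1)⟩ : FreeExt (2 ^ k)) ^ 2 = 1 := by
        rw [sq]
        ext1
        · simp [signedShiftAut_apply, signedShift_of]
        · simp
      rw [h]; simp)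

theorem mk_b_pow : (QuotientGroup.mk' (core k) b) ^ 2 ^ k = 1 := by
  rw [← map_pow]
  exact (QuotientGroup.eq_one_iff _).2 (Subgroup.subset_normalClosure (by simp))

theorem mk_a_sq : (QuotientGroup.mk' (core k) a) ^ 2 = 1 := by
  rw [← map_pow]
  exact (QuotientGroup.eq_one_iff _).2 (Subgroup.subset_normalClosure (by simp))

theorem zpow_units_eq_self {G : Type*} [Group G] {g : G} (hg : g ^ 2 = 1) (e : ℤˣ) :
    g ^ (e : ℤ) = g := by
  rcases Int.units_eq_one_or e with rfl | rfl
  · simp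
  · rw [sq] at hg
    simpa using (eq_inv_of_mul_eq_one_left hg).symm

/-- The retraction of the semidirect product onto the quotient of `P_k` by `core k`. -/
def ofFreeExt (k : ℕ) : FreeExt (2 ^ k) →* GroupP k ⧸ core k :=
  SemidirectProduct.lift
    (FreeGroup.lift fun i =>
      zmodPowHom _ mk_b_pow i * QuotientGroup.mk' (core k) a * (zmodPowHom _ mk_b_pow i)⁻¹)
    ((zmodPowHom _ mk_b_pow).comp (MonoidHom.snd _ _))
    (by
      intro t
      ext i
      simp only [MonoidHom.comp_apply, MulEquiv.coe_toMonoidHom, signedShiftAut_apply,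
        signedShift_of, map_zpow, FreeGroup.lift_apply_of, MonoidHom.coe_snd, MulAut.conj_apply]
      -- Generators go to conjugates of the involution `a`, so inverting them has no effect in the
      -- quotient.
      rw [zpow_units_eq_self (by rw [conj_pow, mk_a_sq]; simp), map_mul]
      group)

theorem ofFreeExt_comp_toFreeExt :
    (ofFreeExt k).comp (toFreeExt k) = QuotientGroup.mk' (core k) := by
  apply hom_ext
  · simp [toFreeExt, ofFreeExt, SemidirectProduct.lift]
  · simp [toFreeExt, ofFreeExt, zmodPowHom_one]

theorem mem_core_of_toFreeExt_eq_one {g : GroupP k} (hg : toFreeExt k g = 1) : g ∈ core k := by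
  rw [← QuotientGroup.eq_one_iff]
  have := DFunLike.congr_fun (ofFreeExt_comp_toFreeExt (k := k)) g
  rw [MonoidHom.comp_apply, hg, map_one] at this
  exact this.symm

end GroupP

/-! ### A finite quotient of `P_k` -/

/-- The parity character of `ℤ/4`. -/
def zmodFourParity : Multiplicative (ZMod 4) →* ℤˣ := zmodPowHom (-1) (by decide)

namespace RegularWreathProduct

/-- The parity of the second component, and the product of all values of the first. -/
def parity : ℤˣ ≀ᵣ Multiplicative (ZMod 4) →* ℤˣ × ℤˣ where
  toFun g := (zmodFourParity g.right, ∏ q, g.left q)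
  map_one' := by simp
  map_mul' g h := by
    ext1
    · simp
    · simpa [Finset.prod_mul_distrib] using Equiv.prod_comp (Equiv.mulLeft g.right⁻¹) h.left

theorem eq_of_zmodFourParity_eq_one {q : Multiplicative (ZMod 4)} (h : zmodFourParity q = 1) :
    q = Multiplicative.ofAdd 0 ∨ q = Multiplicative.ofAdd 2 := by
  revert q; decide

theorem eq_of_zmodFourParity_eq_neg_one {q : Multiplicative (ZMod 4)}
    (h : zmodFourParity q = -1) :
    q = Multiplicative.ofAdd 1 ∨ q = Multiplicative.ofAdd 3 := by
  revert q; decide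

-- Let `p`, `e` be the `ℤ/4`-components of `u`, `v`, and write `ℤ/4` additively. Here `2e = 2`, so
-- the relation at `q` equates `l q * l (q + 2)` with a product of values of `m` that turns out to
-- be `1`. Taking `q = 0, 1` makes the product of all `l q` equal to `1`, against the parity of `u`.
open Multiplicative in
theorem not_conj_sq_of_parity {u v : ℤˣ ≀ᵣ Multiplicative (ZMod 4)} (hu : parity u = (1, -1))
    (hv : parity v = (-1, 1)) : u * v ^ 2 * u⁻¹ * v ^ 2 ≠ 1 := by
  intro h
  obtain ⟨l, p⟩ := u
  obtain ⟨m, e⟩ := v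
  have hp := eq_of_zmodFourParity_eq_one (congrArg Prod.fst hu)
  have he := eq_of_zmodFourParity_eq_neg_one (congrArg Prod.fst hv)
  have hprod : ∀ f : Multiplicative (ZMod 4) → ℤˣ, ∏ q, f q =
      f (ofAdd 0) * f (ofAdd 1) * f (ofAdd 2) * f (ofAdd 3) := fun f => Fin.prod_univ_four f
  have hl : l (ofAdd 0) * l (ofAdd 1) * l (ofAdd 2) * l (ofAdd 3) = -1 :=
    (hprod l).symm.trans (congrArg Prod.snd hu)
  have hm : m (ofAdd 0) * m (ofAdd 1) * m (ofAdd 2) * m (ofAdd 3) = 1 :=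
    (hprod m).symm.trans (congrArg Prod.snd hv)
  have key : ∀ q, l q * (m (p⁻¹ * q) * m (e⁻¹ * (p⁻¹ * q))) *
      l (p * ((p * (e * e))⁻¹ * q)) * (m ((p * (e * e) * p⁻¹)⁻¹ * q) *
      m (e⁻¹ * ((p * (e * e) * p⁻¹)⁻¹ * q))) = 1 := by
    intro q
    rw [sq] at h
    rw [← Int.units_inv_eq_self (l (p * _))]
    exact congrFun (congrArg left h) q
  -- If `p = 2`, the two `m`-factors coincide and cancel (`hsame`); if `p = 0`, together they run
  -- over all four values of `m`, whose product is `1` (`hcyc`).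
  have hsame : ∀ x y z w : ℤˣ, x * (y * z) * w * (y * z) = 1 → x * w = 1 := by decide
  have hcyc : ∀ x y z w s t : ℤˣ, x * (y * z) * w * (s * t) = 1 → y * z * s * t = 1 →
      x * w = 1 := by decide
  have hsplit : l (ofAdd 0) * l (ofAdd 2) = 1 ∧ l (ofAdd 1) * l (ofAdd 3) = 1 := by
    have h0 := key (ofAdd 0)
    have h1 := key (ofAdd 1)
    rcases hp with rfl | rfl
    · rcases he with rfl | rfl
      · exact ⟨hcyc _ _ _ _ _ _ h0 (show m (ofAdd 0) * m (ofAdd 3) * m (ofAdd 2) * m (ofAdd 1) = 1 by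
          rw [← hm]; ac_rfl),
          hcyc _ _ _ _ _ _ h1 (show m (ofAdd 1) * m (ofAdd 0) * m (ofAdd 3) * m (ofAdd 2) = 1 by
          rw [← hm]; ac_rfl)⟩
      · exact ⟨hcyc _ _ _ _ _ _ h0 hm, hcyc _ _ _ _ _ _ h1 (show m (ofAdd 1) * m (ofAdd 2) * m (ofAdd 3) * m (ofAdd 0) = 1 by
          rw [← hm]; ac_rfl)⟩
    · rcases he with rfl | rfl <;> exact ⟨hsame _ _ _ _ h0, hsame _ _ _ _ h1⟩
  have : l (ofAdd 0) * l (ofAdd 1) * l (ofAdd 2) * l (ofAdd 3) = 1 := by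
    rw [mul_right_comm (l (ofAdd 0)), hsplit.1, one_mul, hsplit.2]
  rw [this] at hl
  exact absurd hl (by decide)

end RegularWreathProduct

namespace GroupP

variable {k : ℕ}

/-- The map from `P_k` to the wreath product of `ℤ/2` and `ℤ/4`, for `k ≥ 2`. -/
def toWreath (hk : 1 < k) : GroupP k →* ℤˣ ≀ᵣ Multiplicative (ZMod 4) :=
  lift ⟨Pi.mulSingle 1 (-1), 1⟩ (RegularWreathProduct.inl (Multiplicative.ofAdd 1))
    (by
      have h : (RegularWreathProduct.inl (Multiplicative.ofAdd 1) :
          ℤˣ ≀ᵣ Multiplicative (ZMod 4)) ^ 2 ^ k = 1 := by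
        -- This is where `k > 1` enters: `4` must divide `2 ^ k`.
        obtain ⟨m, rfl⟩ := Nat.exists_eq_add_of_lt hk
        rw [← map_pow, show 2 ^ (1 + m + 1) = 4 * 2 ^ m by ring, pow_mul, ofAdd_one_pow_self,
          one_pow, map_one]
      rw [h]; simp)
    (by
      have h : (⟨Pi.mulSingle 1 (-1), 1⟩ : ℤˣ ≀ᵣ Multiplicative (ZMod 4)) ^ 2 = 1 := by
        rw [sq]
        ext1
        · simp [← Pi.mulSingle_mul]
        · simp
      rw [h]; simp)

theorem parity_comp_toWreath (hk : 1 < k) :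
    RegularWreathProduct.parity.comp (toWreath hk) = sign := by
  apply hom_ext
  · simp only [MonoidHom.comp_apply, toWreath, sign, lift_a]
    decide
  · simp only [MonoidHom.comp_apply, toWreath, sign, lift_b]
    decide

theorem not_conj_sq_of_sign (hk : 1 < k) {u v : GroupP k} (hu : sign u = (1, -1))
    (hv : sign v = (-1, 1)) : u * v ^ 2 * u⁻¹ * v ^ 2 ≠ 1 := by
  intro h
  rw [← parity_comp_toWreath hk] at hu hv
  exact RegularWreathProduct.not_conj_sq_of_parity hu hv
    (by simpa using congrArg (toWreath hk) h)

/-! ### Subgroups isomorphic to Promislow's group -/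

/-- Each of `u`, `v` fixes its own `n`-th power and inverts the other's, and neither power equals
its inverse. So the signs differ, neither is trivial, and neither is `(-1, -1)`, which would invert
all of `core k`. Only the case excluded by the wreath product remains. -/
theorem not_invertSquares_of_pow_mem_core (hk : 1 < k) {u v : GroupP k} (h : InvertSquares u v)
    {n : ℕ} (hn : n ≠ 0) (hn2 : Even n) (hu : ∀ m ≠ 0, u ^ m ≠ 1) (hv : ∀ m ≠ 0, v ^ m ≠ 1)
    (hun : u ^ n ∈ core k) (hvn : v ^ n ∈ core k) : False := by
  have self_conj : ∀ w : GroupP k, w * w ^ n * w⁻¹ = w ^ n := fun w => by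
    rw [← pow_succ', pow_succ, mul_inv_cancel_right]
  have ne_inv : ∀ w : GroupP k, (∀ m ≠ 0, w ^ m ≠ 1) → w ^ n ≠ (w ^ n)⁻¹ := fun w hw hwn =>
    hw (n + n) (by omega) (by rw [pow_add]; exact eq_inv_iff_mul_eq_one.1 hwn)
  have h_sign_ne : sign u ≠ sign v := fun e => ne_inv u hu <| by
    rw [← h.symm.conj_pow hn2, ← conj_eq_conj_of_sign_eq hun e, self_conj]
  have ne_one : ∀ {u v : GroupP k}, InvertSquares u v → (∀ m ≠ 0, v ^ m ≠ 1) →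
      v ^ n ∈ core k → sign u ≠ 1 := fun {u v} h hv hvn e => ne_inv v hv <| by
    rw [← h.conj_pow hn2, conj_eq_self_of_sign_eq_one hvn e]
  have ne_neg_one : ∀ w : GroupP k, (∀ m ≠ 0, w ^ m ≠ 1) → w ^ n ∈ core k →
      sign w ≠ (-1, -1) := fun w hw hwn e => ne_inv w hw <| by
    rw [← conj_eq_inv_of_sign_eq_neg_one hwn e, self_conj]
  have cases_sign : ∀ p q : ℤˣ × ℤˣ, p ≠ q → p ≠ 1 → q ≠ 1 → p ≠ (-1, -1) → q ≠ (-1, -1) →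
      p = (1, -1) ∧ q = (-1, 1) ∨ q = (1, -1) ∧ p = (-1, 1) := by
    have : ∀ p : ℤˣ × ℤˣ, p ≠ 1 → p ≠ (-1, -1) → p = (1, -1) ∨ p = (-1, 1) := by decide
    intro p q hpq hp hq hp' hq'
    rcases this p hp hp' with rfl | rfl <;> rcases this q hq hq' with rfl | rfl <;> simp_all
  rcases cases_sign _ _ h_sign_ne (ne_one h hv hvn) (ne_one h.symm hu hun) (ne_neg_one u hu hun)
    (ne_neg_one v hv hvn) with ⟨h₁, h₂⟩ | ⟨h₁, h₂⟩
  · exact not_conj_sq_of_sign hk h₁ h₂ h.left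
  · exact not_conj_sq_of_sign hk h₁ h₂ h.right

theorem not_injective_of_promislow (hk : 1 < k) (f : GroupP 1 →* GroupP k) :
    ¬ Function.Injective f := by
  intro hf
  have hn : Even (2 ^ k) := (Nat.even_pow.2 ⟨even_two, by omega⟩)
  have hn0 : 2 ^ k ≠ 0 := by positivity
  have hT : ∀ t : ℤˣ × Multiplicative (ZMod (2 ^ k)), t ^ 2 ^ k = 1 := by
    rintro ⟨s, t⟩
    ext1
    · obtain ⟨m, hm⟩ := hn.two_dvd
      change s ^ 2 ^ k = 1
      rw [hm, pow_mul, Int.units_sq, one_pow]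
    · rw [Prod.pow_mk, ← ofAdd_toAdd t, ← ofAdd_nsmul]
      simp
  have dichotomy : ∀ {u v : GroupP 1}, InvertSquares u v →
      f u ^ 2 ^ k ∈ core k ∨ f v ^ 2 ^ k ∈ core k := fun {u v} h => by
    refine (((h.map f).map (toFreeExt k)).pow_eq_one_or_of_freeGroup hn hT).imp ?_ ?_ <;>
    · intro h
      rw [← map_pow] at h
      exact mem_core_of_toFreeExt_eq_one h
  have infinite : ∀ {g : GroupP 1}, (∀ m ≠ 0, g ^ m ≠ 1) → ∀ m ≠ 0, f g ^ m ≠ 1 :=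
    fun {g} hg m hm h => hg m hm (hf (by rw [map_pow, h, map_one]))
  have contra : ∀ {u v : GroupP 1}, InvertSquares u v → (∀ m ≠ 0, u ^ m ≠ 1) →
      (∀ m ≠ 0, v ^ m ≠ 1) → f u ^ 2 ^ k ∈ core k → ¬ f v ^ 2 ^ k ∈ core k :=
    fun h hu hv h₁ h₂ => not_invertSquares_of_pow_mem_core hk (h.map f) hn0 hn
      (infinite hu) (infinite hv) h₁ h₂
  have hab := invertSquares_generators
  have ha : ∀ m ≠ 0, (a : GroupP 1) ^ m ≠ 1 := fun _ => a_pow_ne_one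
  have hb : ∀ m ≠ 0, (b : GroupP 1) ^ m ≠ 1 := fun _ => b_pow_ne_one
  have hc : ∀ m ≠ 0, ((a : GroupP 1) * b) ^ m ≠ 1 := fun _ => a_mul_b_pow_ne_one
  have d₁ := dichotomy hab
  have d₂ := dichotomy hab.self_mul
  have d₃ := dichotomy hab.mul_self
  have c₁ := contra hab ha hb
  have c₂ := contra hab.self_mul ha hc
  have c₃ := contra hab.mul_self hb hc
  -- Pigeonhole: every pair has a member with power in the core (`d₁`, `d₂`, `d₃`), so two of the
  -- three do, which `c₁`, `c₂`, `c₃` forbid.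
  tauto

theorem not_exists_subgroup_mulEquiv (hk : 1 < k) :
    ¬ ∃ H : Subgroup (GroupP k), Nonempty (H ≃* GroupP 1) := by
  rintro ⟨H, ⟨e⟩⟩
  exact not_injective_of_promislow hk (H.subtype.comp e.symm.toMonoidHom)
    (H.subtype_injective.comp e.symm.injective)

end GroupP

theorem mainTheorem3 :
    (∀ k₁ k₂ : ℕ, k₁ ≠ k₂ →
      IsEmpty (GroupP k₁ ≃* GroupP k₂) ∧
      IsEmpty (Abelianization (GroupP k₁) ≃* Abelianization (GroupP k₂))) ∧
    (∀ k : ℕ, 1 < k → ¬ ∃ H : Subgroup (GroupP k), Nonempty (H ≃* PromislowGroup)) := by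
  refine ⟨fun k₁ k₂ h => ?_, fun k hk => ?_⟩
  · have hab := GroupP.isEmpty_abelianization_mulEquiv h
    exact ⟨⟨fun e => hab.false e.abelianizationCongr⟩, hab⟩
  · unfold PromislowGroup
    rw [← relatorsP_one]
    exact GroupP.not_exists_subgroup_mulEquiv hk
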